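/- Let $k$ be a field of characteristic $0$, let $A$ be a finite-dimensional basic $k$-algebra with $J(A)^2=0$, where $J$ denotes the Jacobson radical and basic means that the quotient by the radical is isomorphic to $k^n$ for some $n$, and let $B\subseteq A$ be a (unital) basic subalgebra with $J(B)^2=0$. Assume that the Gabriel quiver $Q_B$ is a subquiver of the Gabriel quiver $Q_A$ with the same vertices, in the following sense: there are elements $(e_i)_{i\in V}$ of $B$ that form a complete set of primitive orthogonal idempotents both of $A$ and of $B$; $Q_A$ is a quiver with vertex set $V$ whose arrows $i\to j$ are in bijection with a $k$-basis of $e_j(J(A)/J(A)^2)e_i$; and $Q_B$ is obtained from $Q_A$ by keeping all vertices and some of the arrows, so that its arrows $i\to j$ are in bijection with a $k$-basis of $e_j(J(B)/J(B)^2)e_i$. Let $\operatorname{HH}^1(A|B)=\operatorname{Der}_{B^e}(A)/\operatorname{Inn}_{B^e}(A)$ be the first relative Hochschild cohomology, that is, the Lie algebra (under the commutator bracket) of those $k$-derivations of $A$ that are $B$-bimodule homomorphisms, modulo the ideal of those inner derivations that are $B$-bimodule homomorphisms. Let $Q_C$ be the quiver with vertex set $V$ whose arrows are the arrows of $Q_A$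 that are not in $Q_B$. Call two arrows parallel if they have the same source and the same target, write $|\alpha|$ for the number of arrows in the class $[\alpha]$ of arrows of $Q_C$ parallel to $\alpha$, and let $S$ be the set of those classes $[\alpha]$ of arrows of $Q_C$ with $|\alpha|>1$. Then there is an isomorphism of Lie algebras over $k$ \[ \operatorname{HH}^1(A|B)/\operatorname{rad}\bigl(\operatorname{HH}^1(A|B)\bigr)\;\cong\;\prod_{[\alpha]\in S}\mathfrak{sl}_{|\alpha|}(k), \] where $\operatorname{rad}$ denotes the largest solvable ideal. -/

import Mathlib

attribute [local instance 100] LieRing.ofAssociativeRing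

/-! ### Products of Lie algebras -/

section PiLie

/-- The product of a family of Lie rings, with the componentwise bracket. -/
instance piLieRing {ι : Type*} (L : ι → Type*) [∀ i, LieRing (L i)] : LieRing (∀ i, L i) where
  bracket x y := fun i => ⁅x i, y i⁆
  add_lie x y z := funext fun i => add_lie (x i) (y i) (z i)
  lie_add x y z := funext fun i => lie_add (x i) (y i) (z i)
  lie_self x := funext fun i => lie_self (x i)
  leibniz_lie x y z := funext fun i => leibniz_lie (x i) (y i) (z i)

/-- The product of a family of Lie algebras. -/
instance piLieAlgebra {k ι : Type*} [CommRing k] (L : ι → Type*) [∀ i, LieRing (L i)]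
    [∀ i, LieAlgebra k (L i)] : LieAlgebra k (∀ i, L i) where
  lie_smul t x y := funext fun i => lie_smul t (x i) (y i)

end PiLie

/-! ### Relative first Hochschild cohomology as a Lie algebra -/

section RelativeHochschild

variable (k : Type*) [Field k] {A : Type*} [Ring A] [Algebra k A]

/-- `Der_{B^e}(A)`: the `k`-derivations of the (noncommutative) algebra `A` that are homomorphisms
of `B`-bimodules, a Lie algebra under the commutator bracket. -/
def relDer (B : Subalgebra k A) : LieSubalgebra k (Module.End k A) where
  carrier := {f | (∀ x y : A, f (x * y) = x * f y + f x * y) ∧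
    (∀ b ∈ B, ∀ x : A, f (b * x) = b * f x) ∧ (∀ b ∈ B, ∀ x : A, f (x * b) = f x * b)}
  add_mem' := by
    rintro f g ⟨hf, hf₁, hf₂⟩ ⟨hg, hg₁, hg₂⟩
    refine ⟨fun x y => ?_, fun b hb x => ?_, fun b hb x => ?_⟩
    · simp only [LinearMap.add_apply, hf, hg]; noncomm_ring
    · simp only [LinearMap.add_apply, hf₁ b hb, hg₁ b hb, mul_add]
    · simp only [LinearMap.add_apply, hf₂ b hb, hg₂ b hb, add_mul]
  zero_mem' := by simp
  smul_mem' := by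
    rintro c f ⟨hf, hf₁, hf₂⟩
    refine ⟨fun x y => ?_, fun b hb x => ?_, fun b hb x => ?_⟩
    · simp [hf]
    · simp [hf₁ b hb]
    · simp [hf₂ b hb]
  lie_mem' := by
    rintro f g ⟨hf, hf₁, hf₂⟩ ⟨hg, hg₁, hg₂⟩
    refine ⟨fun x y => ?_, fun b hb x => ?_, fun b hb x => ?_⟩
    · simp only [Ring.lie_def, LinearMap.sub_apply, Module.End.mul_apply, hf, hg, map_add]
      noncomm_ring
    · simp only [Ring.lie_def, LinearMap.sub_apply, Module.End.mul_apply, hf₁ b hb, hg₁ b hb,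
        mul_sub]
    · simp only [Ring.lie_def, LinearMap.sub_apply, Module.End.mul_apply, hf₂ b hb, hg₂ b hb,
        sub_mul]

/-- `Inn_{B^e}(A)`: the inner derivations `x ↦ a x - x a` that are homomorphisms of
`B`-bimodules, a Lie ideal of `Der_{B^e}(A)`. -/
def relInn (B : Subalgebra k A) : LieIdeal k (relDer k B) where
  carrier := {f | ∃ a : A, ∀ x : A, (f : Module.End k A) x = a * x - x * a}
  add_mem' := by
    rintro f g ⟨a, ha⟩ ⟨b, hb⟩
    refine ⟨a + b, fun x => ?_⟩
    change (f : Module.End k A) x + (g : Module.End k A) x = _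
    rw [ha, hb]
    noncomm_ring
  zero_mem' := ⟨0, by simp⟩
  smul_mem' := by
    rintro c f ⟨a, ha⟩
    refine ⟨c • a, fun x => ?_⟩
    simp [ha, smul_sub]
  lie_mem := by
    rintro f g ⟨a, ha⟩
    refine ⟨(f : Module.End k A) a, fun x => ?_⟩
    have hf := f.2.1
    simp only [LieSubalgebra.coe_bracket, Ring.lie_def, LinearMap.sub_apply,
      Module.End.mul_apply, ha, map_sub, hf]
    noncomm_ring

/-- `HH¹(A|B) = Der_{B^e}(A) / Inn_{B^e}(A)`. -/
abbrev RelHH1 (B : Subalgebra k A) : Type _ := relDer k B ⧸ relInn k B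

end RelativeHochschild

/-! ### Basic algebras, radical square zero algebras and Gabriel quivers -/

section GabrielQuiver

/-- A ring whose Jacobson radical `J` satisfies `J² = 0`. -/
def IsRadicalSquareZero (A : Type*) [Ring A] : Prop :=
  ∀ x ∈ Ring.jacobson A, ∀ y ∈ Ring.jacobson A, x * y = 0

/-- A `k`-algebra is basic if its quotient by the Jacobson radical is a finite product of copies
of `k`. -/
def IsBasicAlgebra (k A : Type*) [Field k] [Ring A] [Algebra k A] : Prop :=
  ∃ n : ℕ, Nonempty ((A ⧸ Ring.jacobson A) ≃ₐ[k] (Fin n → k))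

/-- A primitive idempotent: a nonzero idempotent that is not the sum of two nonzero orthogonal
idempotents. -/
structure IsPrimitiveIdempotent {A : Type*} [Ring A] (e : A) : Prop where
  idem : IsIdempotentElem e
  ne_zero : e ≠ 0
  indecomposable : ∀ f g : A, IsIdempotentElem f → IsIdempotentElem g → f * g = 0 → g * f = 0 →
    e = f + g → f = 0 ∨ g = 0

/-- The Jacobson radical `J` as a `k`-subspace. -/
def jacobsonSubmodule (k A : Type*) [Field k] [Ring A] [Algebra k A] : Submodule k A :=
  (Ring.jacobson A).restrictScalars k

/-- The `k`-space `f (J / J²) e`, as a subspace of `A / J²`. -/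
def arrowSpace (k : Type*) {A : Type*} [Field k] [Ring A] [Algebra k A] (e f : A) :
    Submodule k (A ⧸ (jacobsonSubmodule k A * jacobsonSubmodule k A)) :=
  ((jacobsonSubmodule k A).map (LinearMap.mulLeftRight k (f, e))).map
    (jacobsonSubmodule k A * jacobsonSubmodule k A).mkQ

/-- `Q` is the Gabriel quiver of `A` with respect to `e`: its vertices index a complete set of
primitive orthogonal idempotents, and the arrows from `i` to `j` index a basis of
`e_j (J / J²) e_i`. -/
structure IsGabrielQuiver (k : Type*) {A V : Type*} [Field k] [Ring A] [Algebra k A] [Fintype V]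
    (Q : Quiver V) (e : V → A) : Prop where
  complete : CompleteOrthogonalIdempotents e
  primitive : ∀ i, IsPrimitiveIdempotent (e i)
  arrows : ∀ i j, Nonempty (Module.Basis (Q.Hom i j) k (arrowSpace k (e i) (e j)))

end GabrielQuiver

/-! ### Subquivers, complements and classes of parallel arrows -/

section Quivers

/-- A wide subquiver as a quiver with the same vertices. -/
abbrev subQuiver {V : Type*} [Quiver V] (H : WideSubquiver V) : Quiver V :=
  ⟨fun i j => {a : i ⟶ j // a ∈ H i j}⟩

/-- The complement: same vertices, and the arrows that are not in `H`. -/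
abbrev complQuiver {V : Type*} [Quiver V] (H : WideSubquiver V) : Quiver V :=
  ⟨fun i j => {a : i ⟶ j // a ∉ H i j}⟩

/-- Two arrows are parallel if they have the same source and the same target. -/
def parallelSetoid {V : Type*} (Q : Quiver V) : Setoid (@Quiver.Total V Q) where
  r a b := a.left = b.left ∧ a.right = b.right
  iseqv := ⟨fun _ => ⟨rfl, rfl⟩, fun h => ⟨h.1.symm, h.2.symm⟩,
    fun h h' => ⟨h.1.trans h'.1, h.2.trans h'.2⟩⟩

/-- The equivalence classes of parallel arrows. -/
abbrev ParallelClass {V : Type*} (Q : Quiver V) : Type _ := Quotient (parallelSetoid Q)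

/-- The number of arrows in a class of parallel arrows. -/
noncomputable def ParallelClass.size {V : Type*} {Q : Quiver V} (c : ParallelClass Q) : ℕ :=
  Nat.card {a : @Quiver.Total V Q // Quotient.mk (parallelSetoid Q) a = c}

/-- The parallel complement: the classes of at least two parallel arrows in the complement. -/
abbrev ParallelComplement {V : Type*} [Quiver V] (H : WideSubquiver V) : Type _ :=
  {c : ParallelClass (complQuiver H) // 1 < c.size}

end Quivers

/-!
Both algebras are split: `A = k ^ V ⊕ J` with `J ^ 2 = 0`, and `B` contains the diagonal `k ^ V`.
A relative derivation vanishes on `B`, so it acts on `A / B`, and it preserves each Peirce block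
`e_j (A / B) e_i`. Any linear map `A / B → J` that respects the blocks is a relative derivation, so
the actions fill up the product of the `𝔤𝔩` of all blocks. A derivation acting by zero maps `A` into
`B`, where all relative derivations vanish, so two such derivations commute. Inner derivations act
on every block by a scalar. Taking traceless parts on the blocks of dimension at least two therefore
gives a surjection of `HH¹(A|B)` onto a product of `𝔰𝔩ₙ`. Its kernel acts by scalars on every block,
hence is metabelian, and the target has trivial radical, so this kernel is the radical. The block
`e_j (A / B) e_i` has as many dimensions as there are arrows `i → j` in `Q_A` outside `Q_B`, by
comparing `e_j J(A) e_i` with `e_j J(B) e_i = e_j J(A) e_i ∩ B`.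
-/

/-! ### Radicals of Lie algebras -/

section LieRadical

open LieAlgebra

variable {R L M : Type*} [CommRing R] [LieRing L] [LieAlgebra R L] [LieRing M] [LieAlgebra R M]

theorem isSolvable_map_of_surjective (f : L →ₗ⁅R⁆ M) (hf : Function.Surjective f)
    (I : LieIdeal R L) [IsSolvable I] : IsSolvable (I.map f) := by
  let g : I →ₗ⁅R⁆ I.map f :=
    { toFun := fun x => ⟨f x, LieIdeal.mem_map x.2⟩
      map_add' := fun x y => Subtype.ext (by simp)
      map_smul' := fun c x => Subtype.ext (by simp)
      map_lie' := fun {x y} => Subtype.ext (by simp) }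
  have hg : Function.Surjective g := by
    rintro ⟨y, hy⟩
    obtain ⟨x, hx⟩ := LieIdeal.mem_map_of_surjective hf hy
    exact ⟨x, Subtype.ext hx⟩
  exact hg.lieAlgebra_isSolvable (R := R)

theorem radical_le_ker_of_surjective [HasTrivialRadical R M] (f : L →ₗ⁅R⁆ M)
    (hf : Function.Surjective f) : radical R L ≤ f.ker := by
  refine sSup_le fun I hI => ?_
  have : IsSolvable I := hI
  have : IsSolvable (I.map f) := isSolvable_map_of_surjective f hf I
  exact LieIdeal.map_eq_bot_iff.1 (HasTrivialRadical.eq_bot_of_isSolvable _)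

theorem radical_eq_ker_of_surjective [HasTrivialRadical R M] (f : L →ₗ⁅R⁆ M)
    (hf : Function.Surjective f) [IsSolvable f.ker] : radical R L = f.ker :=
  le_antisymm (radical_le_ker_of_surjective f hf) (le_sSup ‹IsSolvable f.ker›)

/-- The homomorphism out of a quotient of a Lie algebra induced by a homomorphism that kills the
ideal. -/
def lieQuotientLift (I : LieIdeal R L) (f : L →ₗ⁅R⁆ M) (h : I ≤ f.ker) : L ⧸ I →ₗ⁅R⁆ M :=
  { Submodule.liftQ I.toSubmodule (f : L →ₗ[R] M) (fun x hx => by simpa using h hx) with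
    map_lie' := by
      intro x y
      induction x using Submodule.Quotient.induction_on
      induction y using Submodule.Quotient.induction_on
      exact LieHom.map_lie f _ _ }

theorem isSolvable_ker_lieQuotientLift (I : LieIdeal R L) (f : L →ₗ⁅R⁆ M) (h : I ≤ f.ker)
    [IsSolvable f.ker] : IsSolvable (lieQuotientLift I f h).ker := by
  let q : f.ker →ₗ⁅R⁆ (lieQuotientLift I f h).ker :=
    { toFun := fun x => ⟨LieSubmodule.Quotient.mk (x : L), x.2⟩
      map_add' := fun _ _ => rfl
      map_smul' := fun _ _ => rfl
      map_lie' := rfl }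
  have hq : Function.Surjective q := by
    rintro ⟨x, hx⟩
    induction x using Submodule.Quotient.induction_on with | _ x
    exact ⟨⟨x, hx⟩, rfl⟩
  exact hq.lieAlgebra_isSolvable (R := R)

theorem nonempty_quotient_radical_equiv [HasTrivialRadical R M] (f : L →ₗ⁅R⁆ M)
    (hf : Function.Surjective f) [IsSolvable f.ker] (I : LieIdeal R L) (hI : I ≤ f.ker) :
    Nonempty (((L ⧸ I) ⧸ radical R (L ⧸ I)) ≃ₗ⁅R⁆ M) := by
  let g := lieQuotientLift I f hI
  have hg : Function.Surjective g := fun y => by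
    obtain ⟨x, rfl⟩ := hf y
    exact ⟨LieSubmodule.Quotient.mk x, rfl⟩
  have : IsSolvable g.ker := isSolvable_ker_lieQuotientLift I f hI
  rw [radical_eq_ker_of_surjective g hg]
  exact ⟨g.quotKerEquivRange.trans
    ((LieEquiv.ofEq _ ⊤ (by rw [(LieHom.range_eq_top g).2 hg])).trans LieSubalgebra.topEquiv)⟩

theorem isSolvable_of_lie_lie_lie_eq_zero (h : ∀ x y z w : L, ⁅⁅x, y⁆, ⁅z, w⁆⁆ = 0) :
    IsSolvable L := by
  have hspan : ∀ u ∈ ⁅(⊤ : LieIdeal ℤ L), (⊤ : LieIdeal ℤ L)⁆, ∀ v : L,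
      (∀ x y : L, ⁅⁅x, y⁆, v⁆ = 0) → ⁅u, v⁆ = 0 := by
    intro u hu v hv
    rw [← LieSubmodule.mem_toSubmodule, LieSubmodule.lieIdeal_oper_eq_linear_span'] at hu
    induction hu using Submodule.span_induction with
    | mem u hu => obtain ⟨x, -, y, -, rfl⟩ := hu; exact hv x y
    | zero => simp
    | add a b _ _ ha hb => rw [add_lie, ha, hb, add_zero]
    | smul c a _ ha => rw [smul_lie, ha, smul_zero]
  refine IsSolvable.mk (R := ℤ) (k := 2) ?_
  rw [derivedSeries_def, derivedSeriesOfIdeal_succ,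
    derivedSeriesOfIdeal_succ, derivedSeriesOfIdeal_zero, LieSubmodule.lie_eq_bot_iff]
  intro u hu v hv
  refine hspan u hu v fun x y => ?_
  rw [← lie_skew, hspan v hv ⁅x, y⁆ fun z w => h z w x y, neg_zero]

end LieRadical

section PiLieHom

variable {R ι : Type*} [CommRing R] (M : ι → Type*) [∀ i, LieRing (M i)] [∀ i, LieAlgebra R (M i)]

/-- Evaluation at one index, as a homomorphism from a product of Lie algebras. -/
def evalLieHom (i : ι) : (∀ i, M i) →ₗ⁅R⁆ M i :=
  { LinearMap.proj i with map_lie' := rfl }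

variable {M}

/-- The homomorphism into a product of Lie algebras with given components. -/
def piLieHom {L : Type*} [LieRing L] [LieAlgebra R L] (f : ∀ i, L →ₗ⁅R⁆ M i) :
    L →ₗ⁅R⁆ ∀ i, M i :=
  { LinearMap.pi fun i => (f i : L →ₗ[R] M i) with
    map_lie' := fun {x y} => funext fun i => (f i).map_lie x y }

instance pi_hasTrivialRadical [∀ i, LieAlgebra.HasTrivialRadical R (M i)] :
    LieAlgebra.HasTrivialRadical R (∀ i, M i) where
  radical_eq_bot := by
    refine (LieSubmodule.eq_bot_iff _).2 fun x hx => funext fun i => ?_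
    have hsurj : Function.Surjective (evalLieHom (R := R) M i) := Function.surjective_eval i
    exact radical_le_ker_of_surjective _ hsurj hx

end PiLieHom

/-! ### The traceless part of an endomorphism -/

section SpecialLinear

open LieAlgebra LieAlgebra.SpecialLinear

theorem lie_eq_zero_of_lie_lie_eq_zero {R : Type*} [Ring R] (h2 : ∀ r : R, 2 • r = 0 → r = 0)
    (hsemiprime : ∀ r : R, (∀ s, r * s * r = 0) → r = 0) {x : R} (hx : ∀ y : R, ⁅x, ⁅x, y⁆⁆ = 0)
    (y : R) : ⁅x, y⁆ = 0 := by
  have hleibniz : ∀ y z : R, ⁅x, y * z⁆ = ⁅x, y⁆ * z + y * ⁅x, z⁆ := fun y z => by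
    simp only [Ring.lie_def]; noncomm_ring
  -- Apply `(ad x) ^ 2 = 0` to a product: the cross terms of the Leibniz rule must vanish.
  have hmul : ∀ y z : R, ⁅x, y⁆ * ⁅x, z⁆ = 0 := fun y z => h2 _ <| by
    have h := hx (y * z)
    simp only [hleibniz, lie_add, hx, zero_mul, mul_zero, zero_add, add_zero] at h
    rw [two_nsmul, h]
  refine hsemiprime _ fun z => ?_
  have h := hmul y (z * y)
  rwa [hleibniz, mul_add, ← mul_assoc, hmul, zero_mul, zero_add, ← mul_assoc] at h

theorem matrix_eq_zero_of_forall_mul_mul_eq_zero {R n : Type*} [Semiring R] [NoZeroDivisors R]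
    [Fintype n] {m : Matrix n n R} (h : ∀ s, m * s * m = 0) :
    m = 0 := by
  classical
  ext i j
  have hij := congrFun (congrFun (h (Matrix.single j i 1)) i) j
  simpa [Matrix.mul_apply, Matrix.single_apply, ite_and] using hij

theorem exists_eq_smul_one_of_lie_eq_zero {R n : Type*} [CommRing R] [Fintype n] [DecidableEq n]
    {x : Matrix n n R} (hx : ∀ y : Matrix n n R, ⁅x, y⁆ = 0) : ∃ t : R, x = t • 1 := by
  obtain ⟨t, rfl⟩ := Matrix.mem_range_scalar_iff_commute_single'.2 fun i j =>
    ((commute_iff_lie_eq (x := x)).2 (hx (Matrix.single i j 1))).symm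
  exact ⟨t, by rw [Matrix.smul_one_eq_diagonal, Matrix.scalar_apply]⟩

variable (k n : Type*) [Field k] [Fintype n] [DecidableEq n] [NeZero (Fintype.card n : k)]

/-- The projection `x ↦ x - (tr x / n) • 1` of `𝔤𝔩ₙ` onto `𝔰𝔩ₙ` along the scalar matrices, for `n`
invertible in `k`. -/
noncomputable def tracelessPart : Matrix n n k →ₗ⁅k⁆ sl n k where
  toFun x := ⟨x - (x.trace / Fintype.card n) • (1 : Matrix n n k), by
    change Matrix.trace _ = 0
    rw [Matrix.trace_sub, Matrix.trace_smul, Matrix.trace_one, smul_eq_mul,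
      div_mul_cancel₀ _ (NeZero.ne _), sub_self]⟩
  map_add' x y := Subtype.ext <| by
    simp only [Matrix.trace_add, add_div, add_smul, AddMemClass.mk_add_mk]
    abel
  map_smul' c x := Subtype.ext <| by
    simp [Matrix.trace_smul, smul_sub, smul_smul, mul_div_assoc]
  map_lie' {x y} := Subtype.ext <| by
    simp only [sl_bracket, Ring.lie_def, Matrix.trace_sub, Matrix.trace_mul_comm x y, sub_self,
      zero_div, zero_smul, sub_zero, mul_sub, sub_mul, mul_smul_comm, smul_mul_assoc, mul_one,
      one_mul, smul_sub, smul_comm (Matrix.trace y / _)]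
    abel

variable {k n}

theorem tracelessPart_add_smul_one (x : Matrix n n k) :
    (tracelessPart k n x : Matrix n n k) + (x.trace / Fintype.card n) • 1 = x :=
  sub_add_cancel _ _

theorem tracelessPart_coe (x : sl n k) : tracelessPart k n x = x := by
  have hx : (x : Matrix n n k).trace = 0 := x.2
  refine Subtype.ext ?_
  simpa [hx] using tracelessPart_add_smul_one (x : Matrix n n k)

theorem tracelessPart_smul_one (t : k) : tracelessPart k n (t • 1) = 0 := by
  refine Subtype.ext ?_
  change t • 1 - _ = (0 : Matrix n n k)
  rw [Matrix.trace_smul, Matrix.trace_one, smul_eq_mul, mul_div_cancel_right₀ _ (NeZero.ne _),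
    sub_self]

instance sl_hasTrivialRadical [NeZero (2 : k)] : HasTrivialRadical k (sl n k) := by
  rw [hasTrivialRadical_iff_no_abelian_ideals]
  refine fun I hI => (LieSubmodule.eq_bot_iff _).2 fun x hx => ?_
  have hsl : ∀ y : sl n k, ⁅x, ⁅x, y⁆⁆ = 0 := fun y =>
    congrArg Subtype.val (hI.trivial ⟨x, hx⟩ ⟨⁅x, y⁆, lie_mem_left k _ I x y hx⟩)
  have hgl : ∀ y : Matrix n n k, ⁅(x : Matrix n n k), ⁅(x : Matrix n n k), y⁆⁆ = 0 := fun y => by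
    have hone : ⁅(x : Matrix n n k), (1 : Matrix n n k)⁆ = 0 := by simp [Ring.lie_def]
    rw [← tracelessPart_add_smul_one y, lie_add, lie_smul, hone, smul_zero, add_zero]
    exact congrArg Subtype.val (hsl (tracelessPart k n y))
  have hcentral := lie_eq_zero_of_lie_lie_eq_zero (R := Matrix n n k)
    (fun m hm => (smul_eq_zero.1 ((ofNat_smul_eq_nsmul k 2 m).trans hm)).resolve_left (NeZero.ne _))
    (fun m => matrix_eq_zero_of_forall_mul_mul_eq_zero) hgl
  obtain ⟨t, ht⟩ := exists_eq_smul_one_of_lie_eq_zero hcentral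
  rw [← tracelessPart_coe x, ht, tracelessPart_smul_one]

/-- The traceless part of the matrix of an endomorphism in a given basis. -/
noncomputable def tracelessMatrix {U : Type*} [AddCommGroup U] [Module k U]
    (b : Module.Basis n k U) : Module.End k U →ₗ⁅k⁆ sl n k :=
  (tracelessPart k n).comp (LinearMap.toMatrixAlgEquiv b).toLieEquiv.toLieHom

section TracelessMatrix

variable {U : Type*} [AddCommGroup U] [Module k U] (b : Module.Basis n k U)

theorem tracelessMatrix_surjective : Function.Surjective (tracelessMatrix b) := fun x =>
  ⟨(LinearMap.toMatrixAlgEquiv b).symm x, by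
    change tracelessPart k n (LinearMap.toMatrixAlgEquiv b _) = x
    rw [AlgEquiv.apply_symm_apply, tracelessPart_coe]⟩

theorem tracelessMatrix_eq_zero_iff {φ : Module.End k U} :
    tracelessMatrix b φ = 0 ↔ ∃ t : k, φ = t • 1 := by
  set m := LinearMap.toMatrixAlgEquiv b
  change tracelessPart k n (m φ) = 0 ↔ _
  constructor
  · intro h
    have hφ := tracelessPart_add_smul_one (m φ)
    rw [h, ZeroMemClass.coe_zero, zero_add] at hφ
    exact ⟨_, m.injective (by rw [← hφ, map_smul, map_one])⟩
  · rintro ⟨t, rfl⟩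
    rw [map_smul, map_one, tracelessPart_smul_one]

end TracelessMatrix

end SpecialLinear

theorem exists_eq_smul_one_of_rank_le_one {k U : Type*} [Field k] [AddCommGroup U] [Module k U]
    (hU : Module.rank k U ≤ 1) (φ : Module.End k U) : ∃ t : k, φ = t • 1 := by
  obtain ⟨v, hv⟩ := rank_le_one_iff.1 hU
  obtain ⟨t, ht⟩ := hv (φ v)
  refine ⟨t, LinearMap.ext fun u => ?_⟩
  obtain ⟨r, rfl⟩ := hv u
  rw [map_smul, ← ht, LinearMap.smul_apply, Module.End.one_apply, smul_comm]

/-! ### Split square zero algebras -/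

section SplitSquareZero

variable {k A V : Type*} [Field k] [Ring A] [Algebra k A]

/-- The algebra `A` is the direct sum of the diagonal `k ^ V`, spanned by the complete orthogonal
idempotents `e`, and of the square zero ideal `ker π`. -/
structure IsSplitSquareZero [Fintype V] (π : A →ₐ[k] (V → k)) (e : V → A) : Prop where
  complete : CompleteOrthogonalIdempotents e
  map_self : ∀ i, π (e i) i = 1
  mul_eq_zero : ∀ x y : A, π x = 0 → π y = 0 → x * y = 0

namespace IsSplitSquareZero

variable [Fintype V] {π : A →ₐ[k] (V → k)} {e : V → A}

theorem map_idempotent [DecidableEq V] (h : IsSplitSquareZero π e) (i : V) :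
    π (e i) = Pi.single i 1 := by
  ext j
  by_cases hij : i = j
  · subst hij
    simpa using h.map_self i
  · have hmul := congrFun (congrArg π (h.complete.ortho hij)) j
    simpa [h.map_self j, Pi.single_apply, Ne.symm hij] using hmul

theorem map_idempotent_mul (h : IsSplitSquareZero π e) (j : V) (x : A) :
    π (e j * x - π x j • e j) = 0 := by
  classical
  ext l
  by_cases hl : l = j
  · subst hl; simp [h.map_idempotent]
  · simp [h.map_idempotent, hl]

theorem map_mul_idempotent (h : IsSplitSquareZero π e) (i : V) (x : A) :
    π (x * e i - π x i • e i) = 0 := by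
  rw [map_sub, map_mul, mul_comm, ← map_mul, ← map_sub, h.map_idempotent_mul]

theorem mul_of_idempotent_mul_eq (h : IsSplitSquareZero π e) {j : V} {u : A} (hu : e j * u = u)
    (hπu : π u = 0) (x : A) : x * u = π x j • u := by
  have hzero := h.mul_eq_zero _ _ (h.map_mul_idempotent j x) hπu
  rwa [sub_mul, mul_assoc, smul_mul_assoc, hu, sub_eq_zero] at hzero

theorem mul_of_mul_idempotent_eq (h : IsSplitSquareZero π e) {i : V} {u : A} (hu : u * e i = u)
    (hπu : π u = 0) (x : A) : u * x = π x i • u := by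
  have hzero := h.mul_eq_zero _ _ hπu (h.map_idempotent_mul i x)
  rwa [mul_sub, ← mul_assoc, mul_smul_comm, hu, sub_eq_zero] at hzero

theorem idempotent_mul_mul_mul_idempotent (h : IsSplitSquareZero π e) (i j : V) (x y : A) :
    e j * (x * y) * e i = π x j • (e j * y * e i) + π y i • (e j * x * e i) -
      (π x j * π y i) • (e j * e i) := by
  have hzero := h.mul_eq_zero _ _ (h.map_idempotent_mul j x) (h.map_mul_idempotent i y)
  rw [← sub_eq_zero, ← hzero]
  simp only [sub_mul, mul_sub, smul_mul_assoc, mul_smul_comm, smul_sub, smul_smul, mul_assoc]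
  module

theorem surjective (h : IsSplitSquareZero π e) : Function.Surjective π := fun a => by
  classical
  refine ⟨∑ i, a i • e i, ?_⟩
  ext j
  simp [h.map_idempotent, Pi.single_apply]

theorem mem_jacobson_iff (h : IsSplitSquareZero π e) {x : A} :
    x ∈ Ring.jacobson A ↔ π x = 0 := by
  constructor
  · intro hx
    have : RingHomSurjective (π : A →+* (V → k)) := ⟨h.surjective⟩
    have hmap := Ring.le_comap_jacobson (π : A →+* (V → k)) hx
    rwa [IsSemisimpleRing.jacobson_eq_bot] at hmap
  · intro hx
    rw [← Ideal.jacobson_bot, Ideal.mem_jacobson_iff]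
    refine fun y => ⟨1 - y * x, ?_⟩
    have hsq := h.mul_eq_zero (y * x) (y * x) (by simp [hx]) (by simp [hx])
    rw [Ideal.mem_bot, show (1 - y * x) * y * x + (1 - y * x) - 1 = -(y * x * (y * x)) by
      noncomm_ring, hsq, neg_zero]

theorem restrict {B : Subalgebra k A} {e : V → B}
    (h : IsSplitSquareZero π (fun i => (e i : A))) : IsSplitSquareZero (π.comp B.val) e where
  complete := (CompleteOrthogonalIdempotents.map_injective_iff B.val.toRingHom
    Subtype.val_injective).1 h.complete
  map_self := h.map_self
  mul_eq_zero x y hx hy := Subtype.ext (h.mul_eq_zero x y hx hy)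

theorem isRadicalSquareZero (h : IsSplitSquareZero π e) : IsRadicalSquareZero A := fun x hx y hy =>
  h.mul_eq_zero x y (h.mem_jacobson_iff.1 hx) (h.mem_jacobson_iff.1 hy)

end IsSplitSquareZero

end SplitSquareZero

/-! ### Primitive idempotents -/

section PrimitiveIdempotents

theorem IsPrimitiveIdempotent.eq_zero_or_eq {R : Type*} [Ring R] {e c : R}
    (he : IsPrimitiveIdempotent e) (hc : IsIdempotentElem c) (hec : e * c = c) (hce : c * e = c) :
    c = 0 ∨ c = e := by
  have hsub : IsIdempotentElem (e - c) := by
    rw [IsIdempotentElem, mul_sub, sub_mul, sub_mul, he.idem.eq, hce, hec, hc.eq, sub_self,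
      sub_zero]
  refine (he.indecomposable c (e - c) hc hsub (by rw [mul_sub, hce, hc.eq, sub_self])
    (by rw [sub_mul, hec, hc.eq, sub_self]) (add_sub_cancel c e).symm).imp_right fun h => ?_
  exact (sub_eq_zero.1 h).symm

theorem IsPrimitiveIdempotent.map {R S : Type*} [Ring R] [Ring S] {f : R →+* S} {e : R}
    (he : IsPrimitiveIdempotent e) (hf : Function.Surjective f)
    (hker : ∀ x ∈ RingHom.ker f, IsNilpotent x) : IsPrimitiveIdempotent (f e) where
  idem := he.idem.map f
  ne_zero h := he.ne_zero (he.idem.eq_zero_of_isNilpotent (hker e h))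
  indecomposable a b ha _ hab hba heab := by
    obtain ⟨c, hc, rfl, hce, hec⟩ := exists_isIdempotentElem_mul_eq_zero_of_ker_isNilpotent f hker
      a (hf a) ha (1 - e) he.idem.one_sub
      (by rw [map_sub, map_one, heab, mul_sub, mul_one, mul_add, ha.eq, hab, add_zero, sub_self])
      (by rw [map_sub, map_one, heab, sub_mul, one_mul, add_mul, ha.eq, hba, add_zero, sub_self])
    rw [mul_sub, mul_one, sub_eq_zero, eq_comm] at hce
    rw [sub_mul, one_mul, sub_eq_zero, eq_comm] at hec
    rcases he.eq_zero_or_eq hc hec hce with rfl | rfl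
    · exact Or.inl (map_zero f)
    · exact Or.inr (left_eq_add.1 heab)

theorem IsPrimitiveIdempotent.exists_eq_single {ι K : Type*} [DecidableEq ι] [Ring K] [IsDomain K]
    {u : ι → K} (hu : IsPrimitiveIdempotent u) : ∃ p, u = Pi.single p 1 := by
  obtain ⟨p, hp⟩ := Function.ne_iff.1 hu.ne_zero
  have hup : u p = 1 := (IsIdempotentElem.iff_eq_zero_or_one.1 (congrFun hu.idem p)).resolve_left hp
  refine ⟨p, ((hu.eq_zero_or_eq (c := Pi.single p 1) ?_ ?_ ?_).resolve_left ?_).symm⟩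
  · rw [IsIdempotentElem, ← Pi.single_mul, one_mul]
  · rw [← Pi.single_mul_right, hup, one_mul]
  · rw [← Pi.single_mul_left, hup, one_mul]
  · exact Pi.single_ne_zero_iff.2 one_ne_zero

variable {k A V : Type*} [Field k] [Ring A] [Algebra k A]

theorem IsBasicAlgebra.exists_algHom (hA : IsBasicAlgebra k A) :
    ∃ (n : ℕ) (π : A →ₐ[k] (Fin n → k)), Function.Surjective π ∧
      ∀ x, π x = 0 ↔ x ∈ Ring.jacobson A := by
  obtain ⟨n, ⟨φ⟩⟩ := hA
  refine ⟨n, (φ : _ →ₐ[k] _).comp (Ideal.Quotient.mkₐ k (Ring.jacobson A)), ?_, fun x => ?_⟩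
  · exact φ.surjective.comp (Ideal.Quotient.mkₐ_surjective k _)
  · simp [Ideal.Quotient.eq_zero_iff_mem]

theorem IsBasicAlgebra.exists_isSplitSquareZero [Fintype V] (hA : IsBasicAlgebra k A)
    (hA₂ : IsRadicalSquareZero A) {e : V → A} (he : CompleteOrthogonalIdempotents e)
    (hprim : ∀ i, IsPrimitiveIdempotent (e i)) :
    ∃ π : A →ₐ[k] (V → k), IsSplitSquareZero π e := by
  obtain ⟨n, ρ, hρ, hker⟩ := hA.exists_algHom
  have hnil : ∀ x ∈ RingHom.ker (ρ : A →+* (Fin n → k)), IsNilpotent x := fun x hx =>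
    ⟨2, by rw [sq]; exact hA₂ x ((hker x).1 hx) x ((hker x).1 hx)⟩
  choose p hp using fun i => ((hprim i).map (f := (ρ : A →+* (Fin n → k))) hρ hnil).exists_eq_single
  have hp' : ∀ i, ρ (e i) = Pi.single (p i) 1 := hp
  have hp_surj : ∀ q, ∃ i, p i = q := fun q => by
    have hone := congrFun (congrArg ρ he.complete) q
    rw [map_sum, map_one, Finset.sum_apply, Pi.one_apply] at hone
    obtain ⟨i, -, hi⟩ := Finset.exists_ne_zero_of_sum_ne_zero (hone.trans_ne one_ne_zero)
    rw [hp', Pi.single_apply, ne_eq, ite_eq_right_iff, not_forall] at hi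
    exact ⟨i, hi.1.symm⟩
  have hmem : ∀ x, (∀ i, ρ x (p i) = 0) → x ∈ Ring.jacobson A := fun x hx =>
    (hker x).1 (funext fun q => by obtain ⟨i, rfl⟩ := hp_surj q; exact hx i)
  refine ⟨AlgHom.pi fun i => (Pi.evalAlgHom k _ (p i)).comp ρ, he, fun i => ?_,
    fun x y hx hy => ?_⟩
  · simp [hp']
  · exact hA₂ x (hmem x (congrFun hx)) y (hmem y (congrFun hy))

end PrimitiveIdempotents

/-! ### The action of relative derivations on Peirce blocks -/

section PeirceBlocks

variable {k A : Type*} [Field k] [Ring A] [Algebra k A] {B : Subalgebra k A}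

theorem relDer_apply_of_mem (D : relDer k B) {b : A} (hb : b ∈ B) :
    (D : Module.End k A) b = 0 := by
  have hone : (D : Module.End k A) 1 = 0 := by simpa using D.2.1 1 1
  simpa [hone] using D.2.2.1 b hb 1

theorem mem_relDer_of_leibniz {f : Module.End k A} (hf : ∀ x y, f (x * y) = x * f y + f x * y)
    (hB : ∀ b ∈ B, f b = 0) : f ∈ relDer k B :=
  ⟨hf, fun b hb x => by rw [hf, hB b hb, zero_mul, add_zero],
    fun b hb x => by rw [hf, hB b hb, mul_zero, zero_add]⟩

/-- The action of `Der_{B^e}(A)` on the quotient space `A / B`; it is well defined because relative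
derivations vanish on `B`. -/
def quotientAction (B : Subalgebra k A) :
    relDer k B →ₗ⁅k⁆ Module.End k (A ⧸ Subalgebra.toSubmodule B) where
  toFun D := Submodule.mapQ _ _ (D : Module.End k A) fun b hb => by
    rw [Submodule.mem_comap, relDer_apply_of_mem D hb]
    exact Submodule.zero_mem _
  map_add' D D' := Submodule.linearMap_qext _ rfl
  map_smul' t D := Submodule.linearMap_qext _ rfl
  map_lie' {D D'} := Submodule.linearMap_qext _ rfl

theorem lie_eq_zero_of_quotientAction_eq_zero {D D' : relDer k B} (hD : quotientAction B D = 0)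
    (hD' : quotientAction B D' = 0) : ⁅D, D'⁆ = 0 := by
  have hmem : ∀ {E : relDer k B}, quotientAction B E = 0 → ∀ x, (E : Module.End k A) x ∈ B :=
    fun hE x => (Submodule.Quotient.mk_eq_zero _).1
      (LinearMap.congr_fun hE (Submodule.Quotient.mk x))
  refine Subtype.ext (LinearMap.ext fun x => ?_)
  change (D : Module.End k A) ((D' : Module.End k A) x) -
    (D' : Module.End k A) ((D : Module.End k A) x) = 0
  rw [relDer_apply_of_mem D (hmem hD' x), relDer_apply_of_mem D' (hmem hD x), sub_zero]

/-- The Peirce block `f (A / B) e` of the `B`-bimodule `A / B`, with source `e` and target `f`. -/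
def peirceQuotient (B : Subalgebra k A) (e f : B) : Submodule k (A ⧸ Subalgebra.toSubmodule B) :=
  LinearMap.range ((Subalgebra.toSubmodule B).mkQ ∘ₗ LinearMap.mulLeftRight k ((f : A), (e : A)))

/-- The map `x ↦ f x e + B` onto the Peirce block `f (A / B) e`. -/
def peirceProj (B : Subalgebra k A) (e f : B) : A →ₗ[k] peirceQuotient B e f :=
  LinearMap.rangeRestrict _

theorem coe_peirceProj (e f : B) (x : A) :
    (peirceProj B e f x : A ⧸ Subalgebra.toSubmodule B) = Submodule.Quotient.mk (f * x * e) :=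
  rfl

theorem peirceProj_surjective (e f : B) : Function.Surjective (peirceProj B e f) :=
  LinearMap.surjective_rangeRestrict _

theorem peirceProj_of_mem (e f : B) {b : A} (hb : b ∈ B) : peirceProj B e f b = 0 :=
  Subtype.ext ((Submodule.Quotient.mk_eq_zero _).2 (B.mul_mem (B.mul_mem f.2 hb) e.2))

theorem quotientAction_peirceProj (e f : B) (D : relDer k B) (x : A) :
    quotientAction B D (peirceProj B e f x) = peirceProj B e f ((D : Module.End k A) x) := by
  refine congrArg (Submodule.Quotient.mk (p := Subalgebra.toSubmodule B)) ?_
  change (D : Module.End k A) (f * x * e) = f * (D : Module.End k A) x * e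
  rw [D.2.2.2 _ e.2, D.2.2.1 _ f.2]

/-- The action of `Der_{B^e}(A)` on the Peirce block `f (A / B) e`. -/
def blockAction (e f : B) : relDer k B →ₗ⁅k⁆ Module.End k (peirceQuotient B e f) where
  toFun D := (quotientAction B D).restrict fun u hu => by
    obtain ⟨x, hx⟩ := peirceProj_surjective e f ⟨u, hu⟩
    rw [← Subtype.coe_mk u hu, ← hx, quotientAction_peirceProj]
    exact Subtype.coe_prop _
  map_add' D D' := by ext; simp
  map_smul' t D := by ext; simp
  map_lie' {D D'} := by ext; simp [Ring.lie_def]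

theorem blockAction_peirceProj (e f : B) (D : relDer k B) (x : A) :
    blockAction e f D (peirceProj B e f x) = peirceProj B e f ((D : Module.End k A) x) :=
  Subtype.ext (quotientAction_peirceProj e f D x)

variable {V : Type*} [Fintype V] {e : V → B}

theorem quotientAction_eq_zero_of_blockAction_eq_zero (he : CompleteOrthogonalIdempotents e)
    {D : relDer k B} (hD : ∀ i j, blockAction (e i) (e j) D = 0) : quotientAction B D = 0 := by
  have hone : ∑ i, (e i : A) = 1 := by
    rw [← AddSubmonoidClass.coe_finsetSum, he.complete, OneMemClass.coe_one]
  refine Submodule.linearMap_qext _ (LinearMap.ext fun x => ?_)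
  have hx : x = ∑ j, ∑ i, (e j : A) * x * e i := by
    simp only [← Finset.mul_sum, ← Finset.sum_mul, hone, one_mul, mul_one]
  change quotientAction B D (Submodule.mkQ _ x) = 0
  rw [hx]
  simp only [map_sum]
  refine Finset.sum_eq_zero fun j _ => Finset.sum_eq_zero fun i _ => ?_
  exact congrArg Subtype.val (LinearMap.congr_fun (hD i j) (peirceProj B (e i) (e j) x))

theorem quotientAction_lie_eq_zero (he : CompleteOrthogonalIdempotents e) {D D' : relDer k B}
    (hD : ∀ i j, ∃ t : k, blockAction (e i) (e j) D = t • 1)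
    (hD' : ∀ i j, ∃ t : k, blockAction (e i) (e j) D' = t • 1) : quotientAction B ⁅D, D'⁆ = 0 :=
  quotientAction_eq_zero_of_blockAction_eq_zero he fun i j => by
    obtain ⟨s, hs⟩ := hD i j
    obtain ⟨t, ht⟩ := hD' i j
    rw [LieHom.map_lie, hs, ht]
    exact (((Commute.refl 1).smul_left s).smul_right t).lie_eq

end PeirceBlocks

/-! ### Relative derivations of split square zero algebras -/

section RadicalBlocks

variable {k A V : Type*} [Field k] [Ring A] [Algebra k A]

/-- The Peirce block `f J e` of the Jacobson radical, with source `e` and target `f`. -/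
def radicalBlock (k : Type*) {A : Type*} [Field k] [Ring A] [Algebra k A] (e f : A) :
    Submodule k A :=
  (jacobsonSubmodule k A).map (LinearMap.mulLeftRight k (f, e))

variable [Fintype V] {π : A →ₐ[k] (V → k)}

namespace IsSplitSquareZero

theorem mem_radicalBlock_iff {e : V → A} (h : IsSplitSquareZero π e) {i j : V} {u : A} :
    u ∈ radicalBlock k (e i) (e j) ↔ π u = 0 ∧ e j * u = u ∧ u * e i = u := by
  constructor
  · rintro ⟨x, hx, rfl⟩
    rw [SetLike.mem_coe, jacobsonSubmodule, Submodule.restrictScalars_mem, h.mem_jacobson_iff] at hx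
    simp only [LinearMap.mulLeftRight_apply]
    refine ⟨by simp [hx], ?_, ?_⟩
    · rw [← mul_assoc, ← mul_assoc, (h.complete.idem j).eq]
    · rw [mul_assoc, (h.complete.idem i).eq]
  · rintro ⟨hπu, hju, hui⟩
    exact ⟨u, h.mem_jacobson_iff.2 hπu, by rw [LinearMap.mulLeftRight_apply, hju, hui]⟩

variable {B : Subalgebra k A} {e : V → B} (h : IsSplitSquareZero π (fun i => (e i : A)))
include h

theorem peirceProj_mul (i j : V) (x y : A) : peirceProj B (e i) (e j) (x * y) =
    π x j • peirceProj B (e i) (e j) y + π y i • peirceProj B (e i) (e j) x := by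
  refine Subtype.ext ((Submodule.Quotient.eq _).2 ?_)
  change e j * (x * y) * e i - (π x j • (e j * y * e i) + π y i • (e j * x * e i)) ∈ B
  rw [h.idempotent_mul_mul_mul_idempotent, sub_sub_cancel_left]
  exact B.neg_mem (B.smul_mem (B.mul_mem (e j).2 (e i).2) _)

theorem peirceQuotient_eq_map_radicalBlock (i j : V) : peirceQuotient B (e i) (e j) =
    (radicalBlock k (e i : A) (e j)).map (Subalgebra.toSubmodule B).mkQ := by
  apply le_antisymm
  · rintro _ ⟨x, rfl⟩
    refine ⟨(e j * x - π x j • e j) * e i, h.mem_radicalBlock_iff.2 ⟨?_, ?_, ?_⟩, ?_⟩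
    · rw [map_mul, h.map_idempotent_mul, zero_mul]
    · rw [← mul_assoc, mul_sub, ← mul_assoc, mul_smul_comm, (h.complete.idem j).eq]
    · rw [mul_assoc, (h.complete.idem i).eq]
    · refine (Submodule.Quotient.eq _).2 ?_
      rw [sub_mul, LinearMap.mulLeftRight_apply, sub_sub_cancel_left, smul_mul_assoc]
      exact B.neg_mem (B.smul_mem (B.mul_mem (e j).2 (e i).2) _)
  · rintro _ ⟨u, hu, rfl⟩
    obtain ⟨-, hju, hui⟩ := h.mem_radicalBlock_iff.1 hu
    exact ⟨u, by rw [LinearMap.comp_apply, LinearMap.mulLeftRight_apply, hju, hui]⟩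

theorem exists_peirceProj_rightInverse (i j : V) :
    ∃ s : peirceQuotient B (e i) (e j) →ₗ[k] radicalBlock k (e i : A) (e j),
      ∀ u, peirceProj B (e i) (e j) (s u : A) = u := by
  have hsurj : LinearMap.range ((peirceProj B (e i) (e j)).domRestrict
      (radicalBlock k (e i : A) (e j))) = ⊤ := by
    refine LinearMap.range_eq_top.2 fun u => ?_
    obtain ⟨x, hx, hxu⟩ := (h.peirceQuotient_eq_map_radicalBlock i j).le u.2
    obtain ⟨-, hjx, hxi⟩ := h.mem_radicalBlock_iff.1 hx
    refine ⟨⟨x, hx⟩, Subtype.ext ?_⟩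
    rw [LinearMap.domRestrict_apply, coe_peirceProj, hjx, hxi, ← hxu, Submodule.mkQ_apply]
  obtain ⟨s, hs⟩ := LinearMap.exists_rightInverse_of_surjective _ hsurj
  exact ⟨s, fun u => LinearMap.congr_fun hs u⟩

theorem blockAction_of_mem_relInn {D : relDer k B} (hD : D ∈ relInn k B) (i j : V) :
    ∃ t : k, blockAction (e i) (e j) D = t • 1 := by
  obtain ⟨a, ha⟩ := hD
  refine ⟨π a j - π a i, LinearMap.ext fun u => ?_⟩
  obtain ⟨s, hs⟩ := h.exists_peirceProj_rightInverse i j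
  obtain ⟨hπ, hj, hi⟩ := h.mem_radicalBlock_iff.1 (s u).2
  rw [← hs u, blockAction_peirceProj, ha, h.mul_of_idempotent_mul_eq hj hπ,
    h.mul_of_mul_idempotent_eq hi hπ, ← sub_smul, map_smul]
  rfl

/-- The relative derivation `x ↦ g (e_j x e_i + B)`, which sends the Peirce block `e_j (A / B) e_i`
to `e_j J e_i` through `g` and vanishes on the other blocks. -/
def blockDerivation {i j : V}
    (g : peirceQuotient B (e i) (e j) →ₗ[k] radicalBlock k (e i : A) (e j)) : relDer k B :=
  ⟨(radicalBlock k (e i : A) (e j)).subtype ∘ₗ g ∘ₗ peirceProj B (e i) (e j),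
    mem_relDer_of_leibniz (fun x y => by
      obtain ⟨hπx, -, hix⟩ := h.mem_radicalBlock_iff.1 (g (peirceProj B (e i) (e j) x)).2
      obtain ⟨hπy, hjy, -⟩ := h.mem_radicalBlock_iff.1 (g (peirceProj B (e i) (e j) y)).2
      simp only [LinearMap.comp_apply, Submodule.subtype_apply, h.peirceProj_mul, map_add, map_smul,
        h.mul_of_idempotent_mul_eq hjy hπy, h.mul_of_mul_idempotent_eq hix hπx])
    fun b hb => by simp [peirceProj_of_mem _ _ hb]⟩

theorem blockAction_blockDerivation_self {i j : V}
    (g : peirceQuotient B (e i) (e j) →ₗ[k] radicalBlock k (e i : A) (e j))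
    (u : peirceQuotient B (e i) (e j)) :
    blockAction (e i) (e j) (h.blockDerivation g) u = peirceProj B (e i) (e j) (g u : A) := by
  obtain ⟨x, rfl⟩ := peirceProj_surjective _ _ u
  rw [blockAction_peirceProj]
  rfl

theorem blockAction_blockDerivation_of_ne {i j i' j' : V} (hne : (i', j') ≠ (i, j))
    (g : peirceQuotient B (e i) (e j) →ₗ[k] radicalBlock k (e i : A) (e j)) :
    blockAction (e i') (e j') (h.blockDerivation g) = 0 := by
  refine LinearMap.ext fun u => ?_
  obtain ⟨x, rfl⟩ := peirceProj_surjective _ _ u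
  obtain ⟨-, hj, hi⟩ := h.mem_radicalBlock_iff.1 (g (peirceProj B (e i) (e j) x)).2
  rw [blockAction_peirceProj]
  refine Subtype.ext (congrArg Submodule.Quotient.mk (?_ : _ = (0 : A)))
  change (e j' : A) * (g (peirceProj B (e i) (e j) x) : A) * e i' = 0
  rcases not_and_or.1 (mt Prod.ext_iff.2 hne) with hi' | hj'
  · rw [mul_assoc, ← hi, mul_assoc, h.complete.ortho (Ne.symm hi'), mul_zero, mul_zero]
  · rw [← hj, ← mul_assoc, h.complete.ortho hj', zero_mul, zero_mul]

theorem exists_relDer_blockAction_eq {ι : Type*} {p : ι → V × V} (hp : Function.Injective p)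
    (φ : ∀ c, Module.End k (peirceQuotient B (e (p c).1) (e (p c).2))) :
    ∃ D : relDer k B, ∀ c, blockAction (e (p c).1) (e (p c).2) D = φ c := by
  classical
  have : Fintype ι := Fintype.ofInjective p hp
  choose s hs using fun c => h.exists_peirceProj_rightInverse (p c).1 (p c).2
  refine ⟨∑ c, h.blockDerivation (s c ∘ₗ φ c), fun c => ?_⟩
  rw [map_sum, Finset.sum_eq_single c]
  · refine LinearMap.ext fun u => ?_
    rw [h.blockAction_blockDerivation_self, LinearMap.comp_apply, hs]
  · exact fun c' _ hc => h.blockAction_blockDerivation_of_ne (hp.ne hc.symm) _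
  · exact fun hc => absurd (Finset.mem_univ c) hc

open LieAlgebra.SpecialLinear in
theorem nonempty_relHH1_quotient_radical_equiv [NeZero (2 : k)] {ι : Type*} {p : ι → V × V}
    (hp : Function.Injective p) {n : ι → Type*} [∀ c, Fintype (n c)] [∀ c, DecidableEq (n c)]
    [∀ c, NeZero (Fintype.card (n c) : k)]
    (b : ∀ c, Module.Basis (n c) k (peirceQuotient B (e (p c).1) (e (p c).2)))
    (hrank : ∀ i j, (i, j) ∉ Set.range p → Module.rank k (peirceQuotient B (e i) (e j)) ≤ 1) :
    Nonempty ((RelHH1 k B ⧸ LieAlgebra.radical k (RelHH1 k B)) ≃ₗ⁅k⁆ ∀ c, sl (n c) k) := by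
  let Φ : relDer k B →ₗ⁅k⁆ ∀ c, sl (n c) k :=
    piLieHom fun c => (tracelessMatrix (b c)).comp (blockAction (e (p c).1) (e (p c).2))
  have hsurj : Function.Surjective Φ := fun m => by
    choose φ hφ using fun c => tracelessMatrix_surjective (b c) (m c)
    obtain ⟨D, hD⟩ := h.exists_relDer_blockAction_eq hp φ
    exact ⟨D, funext fun c => (congrArg (tracelessMatrix (b c)) (hD c)).trans (hφ c)⟩
  have hscalar : ∀ D : Φ.ker, ∀ i j, ∃ t : k, blockAction (e i) (e j) (D : relDer k B) = t • 1 := by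
    intro D i j
    by_cases hij : (i, j) ∈ Set.range p
    · obtain ⟨c, hc⟩ := hij
      obtain ⟨rfl, rfl⟩ := Prod.ext_iff.1 hc
      exact (tracelessMatrix_eq_zero_iff (b c)).1 (congrFun D.2 c)
    · exact exists_eq_smul_one_of_rank_le_one (hrank i j hij) _
  have hsolv : LieAlgebra.IsSolvable Φ.ker := isSolvable_of_lie_lie_lie_eq_zero fun D₁ D₂ D₃ D₄ =>
    Subtype.ext (lie_eq_zero_of_quotientAction_eq_zero
      (quotientAction_lie_eq_zero h.restrict.complete (hscalar D₁) (hscalar D₂))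
      (quotientAction_lie_eq_zero h.restrict.complete (hscalar D₃) (hscalar D₄)))
  refine nonempty_quotient_radical_equiv Φ hsurj (relInn k B) fun D hD => ?_
  exact funext fun c => (tracelessMatrix_eq_zero_iff (b c)).2 (h.blockAction_of_mem_relInn hD _ _)

end IsSplitSquareZero

end RadicalBlocks

/-! ### Counting arrows -/

section ArrowCount

variable {k A V : Type*} [Field k] [Ring A] [Algebra k A]

theorem IsRadicalSquareZero.finrank_arrowSpace (hA : IsRadicalSquareZero A) (e f : A) :
    Module.finrank k (arrowSpace k e f) = Module.finrank k (radicalBlock k e f) := by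
  have hsq : jacobsonSubmodule k A * jacobsonSubmodule k A = ⊥ :=
    eq_bot_iff.2 (Submodule.mul_le.2 hA)
  refine (LinearEquiv.finrank_eq (Submodule.equivMapOfInjective _ ?_ _)).symm
  rw [← LinearMap.ker_eq_bot, Submodule.ker_mkQ, hsq]

theorem IsGabrielQuiver.finrank_radicalBlock [Fintype V] {Q : Quiver V} {e : V → A}
    (hQ : IsGabrielQuiver k Q e) (hA : IsRadicalSquareZero A) (i j : V) :
    Module.finrank k (radicalBlock k (e i) (e j)) = Nat.card (Q.Hom i j) := by
  obtain ⟨b⟩ := hQ.arrows i j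
  rw [← hA.finrank_arrowSpace, Module.finrank_eq_nat_card_basis b]

theorem IsGabrielQuiver.finite_hom [FiniteDimensional k A] [Fintype V] {Q : Quiver V} {e : V → A}
    (hQ : IsGabrielQuiver k Q e) (i j : V) : Finite (Q.Hom i j) := by
  obtain ⟨b⟩ := hQ.arrows i j
  exact Module.Finite.finite_basis b

theorem finrank_map_mkQ_add_finrank_inf {K M : Type*} [DivisionRing K] [AddCommGroup M]
    [Module K M] (U W : Submodule K M) [FiniteDimensional K U] :
    Module.finrank K (U.map W.mkQ) + Module.finrank K (U ⊓ W : Submodule K M) =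
      Module.finrank K U := by
  have hcomap : Module.finrank K (W.comap U.subtype) =
      Module.finrank K (U ⊓ W : Submodule K M) := by
    rw [← Submodule.map_comap_subtype]
    exact (Submodule.equivMapOfInjective _ Subtype.val_injective _).finrank_eq
  rw [← LinearMap.finrank_range_add_finrank_ker (W.mkQ.domRestrict U), LinearMap.range_domRestrict,
    LinearMap.ker_domRestrict, Submodule.ker_mkQ, hcomap]

theorem card_subQuiver_hom_add_card_complQuiver_hom [Quiver V] (H : WideSubquiver V) (i j : V)
    [Finite (i ⟶ j)] : Nat.card ((subQuiver H).Hom i j) + Nat.card ((complQuiver H).Hom i j) =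
      Nat.card (i ⟶ j) := by
  classical
  change Nat.card {a : i ⟶ j // a ∈ H i j} + Nat.card {a : i ⟶ j // a ∉ H i j} = _
  rw [← Nat.card_sum]
  exact Nat.card_congr (Equiv.sumCompl _)

namespace IsSplitSquareZero

variable [Fintype V] {π : A →ₐ[k] (V → k)} {B : Subalgebra k A} {e : V → B}
  (h : IsSplitSquareZero π (fun i => (e i : A)))
include h

theorem map_val_radicalBlock (i j : V) :
    (radicalBlock k (e i) (e j)).map B.val.toLinearMap =
      radicalBlock k (e i : A) (e j) ⊓ Subalgebra.toSubmodule B := by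
  ext x
  constructor
  · rintro ⟨b, hb, rfl⟩
    obtain ⟨hπ, hj, hi⟩ := h.restrict.mem_radicalBlock_iff.1 hb
    exact ⟨h.mem_radicalBlock_iff.2 ⟨hπ, congrArg Subtype.val hj, congrArg Subtype.val hi⟩, b.2⟩
  · rintro ⟨hx, hxB⟩
    obtain ⟨hπ, hj, hi⟩ := h.mem_radicalBlock_iff.1 hx
    exact ⟨⟨x, hxB⟩, h.restrict.mem_radicalBlock_iff.2 ⟨hπ, Subtype.ext hj, Subtype.ext hi⟩, rfl⟩

theorem finrank_peirceQuotient [FiniteDimensional k A] [QA : Quiver V] (QB : WideSubquiver V)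
    (hQA : IsGabrielQuiver k QA (fun i => (e i : A)))
    (hQB : IsGabrielQuiver k (subQuiver QB) e) (i j : V) :
    Module.finrank k (peirceQuotient B (e i) (e j)) = Nat.card ((complQuiver QB).Hom i j) := by
  have : Finite (i ⟶ j) := hQA.finite_hom i j
  have hrank := finrank_map_mkQ_add_finrank_inf (radicalBlock k (e i : A) (e j))
    (Subalgebra.toSubmodule B)
  have hinf := (Submodule.equivMapOfInjective B.val.toLinearMap Subtype.val_injective
    (radicalBlock k (e i) (e j))).finrank_eq
  rw [h.map_val_radicalBlock, hQB.finrank_radicalBlock h.restrict.isRadicalSquareZero] at hinf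
  rw [← h.peirceQuotient_eq_map_radicalBlock, ← hinf,
    hQA.finrank_radicalBlock h.isRadicalSquareZero,
    ← card_subQuiver_hom_add_card_complQuiver_hom QB, add_comm] at hrank
  exact Nat.add_left_cancel hrank

end IsSplitSquareZero

end ArrowCount

/-! ### Classes of parallel arrows -/

section ParallelClasses

variable {V : Type*}

namespace ParallelClass

variable {Q : Quiver V}

/-- The common source and target of the arrows in a class of parallel arrows. -/
def endpoints : ParallelClass Q → V × V :=
  Quotient.lift (fun a : @Quiver.Total V Q => (a.left, a.right)) fun _ _ hab => Prod.ext_iff.2 hab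

theorem endpoints_injective : Function.Injective (endpoints (Q := Q)) := by
  rintro ⟨a⟩ ⟨b⟩ hab
  exact Quotient.sound (Prod.ext_iff.1 hab)

theorem size_eq_card_hom (c : ParallelClass Q) :
    c.size = Nat.card (Q.Hom c.endpoints.1 c.endpoints.2) := by
  refine Nat.card_congr (Equiv.ofBijective (fun a => ⟨⟨_, _, a⟩, endpoints_injective rfl⟩)
    ⟨fun a b hab => ?_, ?_⟩).symm
  · simpa using hab
  · rintro ⟨a, rfl⟩
    exact ⟨a.hom, rfl⟩

theorem exists_endpoints_eq {i j : V} (a : Q.Hom i j) :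
    ∃ c : ParallelClass Q, c.endpoints = (i, j) :=
  ⟨Quotient.mk _ ⟨i, j, a⟩, rfl⟩

end ParallelClass

theorem card_complQuiver_hom_le_one [Quiver V] {H : WideSubquiver V} {i j : V}
    (hij : (i, j) ∉ Set.range fun c : ParallelComplement H => c.1.endpoints) :
    Nat.card ((complQuiver H).Hom i j) ≤ 1 := by
  by_contra! hcard
  obtain ⟨a⟩ : Nonempty ((complQuiver H).Hom i j) := (Nat.card_pos_iff.1 (by omega)).1
  obtain ⟨c, hc⟩ := ParallelClass.exists_endpoints_eq a
  exact hij ⟨⟨c, by rwa [c.size_eq_card_hom, hc]⟩, hc⟩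

end ParallelClasses

theorem mainTheorem11_general {k A V : Type*} [Field k] [NeZero (2 : k)] [Ring A] [Algebra k A]
    [FiniteDimensional k A] (B : Subalgebra k A)
    (hA : IsRadicalSquareZero A) (hA' : IsBasicAlgebra k A)
    [Fintype V] [QA : Quiver V] (QB : WideSubquiver V) (e : V → B)
    (hQA : IsGabrielQuiver k QA (fun i => (e i : A)))
    (hQB : IsGabrielQuiver k (subQuiver QB) e)
    (hsize : ∀ c : ParallelComplement QB, (c.1.size : k) ≠ 0) :
    Nonempty ((RelHH1 k B ⧸ LieAlgebra.radical k (RelHH1 k B)) ≃ₗ⁅k⁆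
      (∀ c : ParallelComplement QB, LieAlgebra.SpecialLinear.sl (Fin c.1.size) k)) := by
  obtain ⟨π, h⟩ := hA'.exists_isSplitSquareZero hA hQA.complete hQA.primitive
  have hdim := h.finrank_peirceQuotient QB hQA hQB
  have hendpoints : Function.Injective fun c : ParallelComplement QB => c.1.endpoints :=
    ParallelClass.endpoints_injective.comp Subtype.val_injective
  have (c : ParallelComplement QB) : NeZero (Fintype.card (Fin c.1.size) : k) :=
    ⟨by rw [Fintype.card_fin]; exact hsize c⟩
  refine h.nonempty_relHH1_quotient_radical_equiv hendpoints (fun c =>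
    Module.finBasisOfFinrankEq k _ ((hdim _ _).trans c.1.size_eq_card_hom.symm)) fun i j hij => ?_
  rw [← Module.finrank_eq_rank, hdim]
  exact_mod_cast card_complQuiver_hom_le_one hij

theorem mainTheorem11 {k A V : Type*} [Field k] [CharZero k] [Ring A] [Algebra k A]
    [FiniteDimensional k A] (B : Subalgebra k A)
    (hA : IsRadicalSquareZero A) (hB : IsRadicalSquareZero B)
    (hA' : IsBasicAlgebra k A) (hB' : IsBasicAlgebra k B)
    [Fintype V] [QA : Quiver V] (QB : WideSubquiver V) (e : V → B)
    (hQA : IsGabrielQuiver k QA (fun i => (e i : A)))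
    (hQB : IsGabrielQuiver k (subQuiver QB) e) :
    Nonempty ((RelHH1 k B ⧸ LieAlgebra.radical k (RelHH1 k B)) ≃ₗ⁅k⁆
      (∀ c : ParallelComplement QB, LieAlgebra.SpecialLinear.sl (Fin c.1.size) k)) :=
  mainTheorem11_general B hA hA' QB e hQA hQB fun c => Nat.cast_ne_zero.2 (by have := c.2; omega)
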